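/- Let $n$ be a positive integer, let $K$ be any field (for instance $\mathbb{C}$, or the field $\mathbb{Q}(q)$ of rational functions in an indeterminate $q$), and let $q\in K$ with $q\neq 0$ and $q\neq q^{-1}$. For integers $a,b$ put $\binom{a}{b}=\frac{a(a-1)\cdots(a-b+1)}{b!}$ if $b\ge 0$ and $\binom{a}{b}=0$ if $b<0$. Define $$J_{i,j}(q)=\sum_{k=-n}^{n+1}(-1)^{k+1}\,\frac{q^k-q^{-k}}{q-q^{-1}}\binom{2j+k-3}{i-1}\left[q\binom{n}{j+k-2}+\binom{n}{j+k-1}\right]\qquad(1\le i,j\le n+1),$$ $$L_{i,j}(q)=\sum_{k=-n+1}^{n}(-1)^{k+1}\,\frac{q^k-q^{-k}}{q-q^{-1}}\binom{2j+k-3}{i-1}\binom{n}{j+k-1}\qquad(1\le i,j\le n),$$ and let $J_{i,j}(q^{-1})$ be given by the same formula as $J_{i,j}(q)$ with $q$ replaced by $q^{-1}$. Then $$\det\bigl(J_{i,j}(q)\bigr)_{1\le i,j\le n+1}=q^{n+2}\det\bigl(J_{i,j}(q^{-1})\bigr)_{1\le i,j\le n+1}=q(1-q)^n(q-q^{-1})^n\det\bigl(L_{i,j}(q)\bigr)_{1\le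 i,j\le n}.$$ -/

import Mathlib

/-- The binomial coefficient `a choose b` for integers `a`, `b`: it is
`a (a - 1) ⋯ (a - b + 1) / b!` for `0 ≤ b`, and `0` for `b < 0`. -/
def intBinom (a b : ℤ) : ℤ :=
  if 0 ≤ b then Ring.choose a b.toNat else 0

/-- The entry `J_{i,j}(q)` (indices start at `1`) of the matrix of size `n + 1`. -/
noncomputable def entryJ {K : Type*} [Field K] (n : ℕ) (q : K) (i j : ℤ) : K :=
  ∑ k ∈ Finset.Icc (-(n : ℤ)) ((n : ℤ) + 1),
    (-1 : K) ^ (k + 1) * ((q ^ k - q ^ (-k)) / (q - q⁻¹)) *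
      (intBinom (2 * j + k - 3) (i - 1) : K) *
      (q * (intBinom n (j + k - 2) : K) + (intBinom n (j + k - 1) : K))

/-- The entry `L_{i,j}(q)` (indices start at `1`) of the matrix of size `n`. -/
noncomputable def entryL {K : Type*} [Field K] (n : ℕ) (q : K) (i j : ℤ) : K :=
  ∑ k ∈ Finset.Icc (-(n : ℤ) + 1) (n : ℤ),
    (-1 : K) ^ (k + 1) * ((q ^ k - q ^ (-k)) / (q - q⁻¹)) *
      (intBinom (2 * j + k - 3) (i - 1) : K) *
      (intBinom n (j + k - 1) : K)

/-- The `(n + 1) × (n + 1)` matrix `(J_{i,j}(q))`, `1 ≤ i, j ≤ n + 1`. -/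
noncomputable def matrixJ {K : Type*} [Field K] (n : ℕ) (q : K) : Matrix (Fin (n + 1)) (Fin (n + 1)) K :=
  Matrix.of fun i j => entryJ n q ((i : ℕ) + 1) ((j : ℕ) + 1)

/-- The `n × n` matrix `(L_{i,j}(q))`, `1 ≤ i, j ≤ n`. -/
noncomputable def matrixL {K : Type*} [Field K] (n : ℕ) (q : K) : Matrix (Fin n) (Fin n) K :=
  Matrix.of fun i j => entryL n q ((i : ℕ) + 1) ((j : ℕ) + 1)

/-! Encode each column by its generating series in the row index. With `y = 1 + X`, the binomial
theorem collapses the sum over `k`: up to a common factor, `y` times column `j` of `J` is `y ^ j`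
times a combination of `(1 - q y) ^ n (1 - q² y)` and `(1 - q⁻¹ y) ^ n (1 - y)`. Adding `q` times
the next column gives both terms the factor `(1 - y)(1 - q² y)`, leaving `-X (1 - q² y)` times a
column of `L` (`colJ_add_smul_colJ_succ`). After these column operations the first row is zero
beyond its first entry `q (1 - q) ^ n`. In the remaining minor, multiplication by `-(1 - q² y)` is a
triangular row operation with diagonal `q (q - q⁻¹)`, so `det L` appears. The claim for `q⁻¹`
follows because `L` is invariant under `q ↦ q⁻¹`. -/

open PowerSeries in
/-- The generating series, in the lower index of the first binomial coefficient, of the sums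
`∑ s ^ k * binom (2 * j + k - 1) i * binom n (k + t)` for `k` from `a` to `b`. -/
noncomputable def binomGen {K : Type*} [Field K] (n : ℕ) (s : K) (j t a b : ℤ) : PowerSeries K :=
  ∑ k ∈ Finset.Icc a b,
    C (s ^ k) * binomialSeries K (2 * j + k - 1) * C (intBinom n (k + t) : K)

/-- The generating series of the column with index `j + 1` of `J`. -/
noncomputable def colJ {K : Type*} [Field K] (n : ℕ) (q : K) (j : ℕ) : PowerSeries K :=
  PowerSeries.C (-(q - q⁻¹)⁻¹) *
    (PowerSeries.C q * (binomGen n (-q) j (j - 1) (-n) (n + 1) -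
        binomGen n (-q⁻¹) j (j - 1) (-n) (n + 1)) +
      (binomGen n (-q) j j (-n) (n + 1) - binomGen n (-q⁻¹) j j (-n) (n + 1)))

/-- The generating series of the column with index `j + 1` of `L`. -/
noncomputable def colL {K : Type*} [Field K] (n : ℕ) (q : K) (j : ℕ) : PowerSeries K :=
  PowerSeries.C (-(q - q⁻¹)⁻¹) *
    (binomGen n (-q) j j (-n + 1) n - binomGen n (-q⁻¹) j j (-n + 1) n)

lemma intBinom_natCast_right (a : ℤ) (i : ℕ) : intBinom a i = Ring.choose a i := by
  simp [intBinom]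

lemma intBinom_natCast (n m : ℕ) : intBinom n m = n.choose m := by
  rw [intBinom_natCast_right, Ring.choose_natCast]

lemma intBinom_eq_zero {n : ℕ} {b : ℤ} (h : b < 0 ∨ (n : ℤ) < b) : intBinom n b = 0 := by
  rcases h with h | h
  · simp [intBinom, h]
  · lift b to ℕ using by omega
    rw [intBinom_natCast, Nat.choose_eq_zero_of_lt (by omega), Nat.cast_zero]

lemma sum_Icc_mul_intBinom {R : Type*} [CommRing R] (n : ℕ) (f : ℤ → R) {a b t : ℤ}
    (ha : a ≤ -t) (hb : n - t ≤ b) :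
    ∑ k ∈ Finset.Icc a b, f k * (intBinom n (k + t) : R) =
      ∑ m ∈ Finset.range (n + 1), f (m - t) * (n.choose m : R) := by
  symm
  refine Finset.sum_of_injOn (fun m : ℕ => (m : ℤ) - t) ?_ ?_ ?_ ?_
  · intro x _ y _ h
    simpa using h
  · intro m hm
    simp only [Finset.coe_range, Set.mem_Iio, Finset.coe_Icc, Set.mem_Icc] at hm ⊢
    omega
  · intro k _ hk
    rw [intBinom_eq_zero, Int.cast_zero, mul_zero]
    by_contra! h
    refine hk ⟨(k + t).toNat, ?_, ?_⟩
    · simp only [Finset.coe_range, Set.mem_Iio]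
      omega
    · simp only
      omega
  · intro m _
    rw [sub_add_cancel, intBinom_natCast, Int.cast_natCast]

open PowerSeries in
lemma one_add_X_mul_binomialSeries {K : Type*} [Field K] {z : ℤ} {e : ℕ} (h : z + 1 = e) :
    (1 + X : PowerSeries K) * binomialSeries K z = (1 + X) ^ e := by
  have h1 : (1 + X : PowerSeries K) = binomialSeries K (1 : ℤ) := by
    simpa using (binomialSeries_nat (R := ℤ) (A := K) 1).symm
  rw [← binomialSeries_nat (R := ℤ) (A := K) e, ← h, h1, ← binomialSeries_add, add_comm]

-- The exponent `2 * j + k - 1` can be `-1`; the extra factor `1 + X` makes all exponents natural.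
-- The bounds on `a` and `b` ensure that the range covers the whole support of the binomial in `k +
-- t`.
open PowerSeries in
lemma one_add_X_mul_binomGen {K : Type*} [Field K] (n : ℕ) {s : K} (hs : s ≠ 0) {j t a b : ℤ}
    {e : ℕ} (he : (e : ℤ) = 2 * j - t) (ha : a ≤ -t) (hb : n - t ≤ b) :
    (1 + X) * binomGen n s j t a b =
      C (s ^ (-t)) * (1 + X) ^ e * (1 + C s * (1 + X)) ^ n := by
  have h := sum_Icc_mul_intBinom n
    (fun k : ℤ => C (s ^ k) * ((1 + X : PowerSeries K) * binomialSeries K (2 * j + k - 1))) ha hb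
  rw [binomGen, Finset.mul_sum]
  refine Eq.trans ?_ (h.trans ?_)
  · apply Finset.sum_congr rfl
    intro k _
    rw [map_intCast]
    ring
  · rw [add_comm 1 (C s * (1 + X)), add_pow (C s * (1 + X)), Finset.mul_sum]
    apply Finset.sum_congr rfl
    intro m _
    rw [one_add_X_mul_binomialSeries (e := e + m) (by push_cast; omega), sub_eq_neg_add,
      zpow_add₀ hs, zpow_natCast, map_mul, map_pow, mul_pow]
    ring

open PowerSeries in
lemma coeff_binomGen {K : Type*} [Field K] (n : ℕ) (s : K) (j t a b : ℤ) (i : ℕ) :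
    coeff i (binomGen n s j t a b) =
      ∑ k ∈ Finset.Icc a b,
        s ^ k * (intBinom (2 * j + k - 1) i : K) * (intBinom n (k + t) : K) := by
  rw [binomGen, map_sum]
  refine Finset.sum_congr rfl fun k _ => ?_
  rw [coeff_mul_C, coeff_C_mul, binomialSeries_coeff, intBinom_natCast_right, zsmul_one]

lemma neg_one_zpow_succ_mul_sub {K : Type*} [Field K] (q : K) (k : ℤ) :
    (-1 : K) ^ (k + 1) * ((q ^ k - q ^ (-k)) / (q - q⁻¹)) =
      -(q - q⁻¹)⁻¹ * ((-q) ^ k - (-q⁻¹) ^ k) := by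
  rw [neg_eq_neg_one_mul q, neg_eq_neg_one_mul q⁻¹, mul_zpow, mul_zpow, inv_zpow', zpow_add₀
    (neg_ne_zero.2 one_ne_zero), zpow_one]
  ring

lemma matrixJ_apply {K : Type*} [Field K] (n : ℕ) (q : K) (i j : Fin (n + 1)) :
    matrixJ n q i j = PowerSeries.coeff i (colJ n q j) := by
  simp only [matrixJ, Matrix.of_apply, entryJ, colJ, PowerSeries.coeff_C_mul, map_add, map_sub,
    coeff_binomGen, ← Finset.sum_sub_distrib, Finset.mul_sum, ← Finset.sum_add_distrib]
  refine Finset.sum_congr rfl fun k _ => ?_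
  rw [neg_one_zpow_succ_mul_sub, add_sub_cancel_right,
    show 2 * ((j : ℕ) + 1 : ℤ) + k - 3 = 2 * (j : ℕ) + k - 1 by ring,
    show ((j : ℕ) + 1 : ℤ) + k - 2 = k + ((j : ℕ) - 1) by ring,
    show ((j : ℕ) + 1 : ℤ) + k - 1 = k + (j : ℕ) by ring]
  ring

lemma matrixL_apply {K : Type*} [Field K] (n : ℕ) (q : K) (i j : Fin n) :
    matrixL n q i j = PowerSeries.coeff i (colL n q j) := by
  simp only [matrixL, Matrix.of_apply, entryL, colL, PowerSeries.coeff_C_mul, map_sub,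
    coeff_binomGen, ← Finset.sum_sub_distrib, Finset.mul_sum]
  refine Finset.sum_congr rfl fun k _ => ?_
  rw [neg_one_zpow_succ_mul_sub, add_sub_cancel_right,
    show 2 * ((j : ℕ) + 1 : ℤ) + k - 3 = 2 * (j : ℕ) + k - 1 by ring,
    show ((j : ℕ) + 1 : ℤ) + k - 1 = k + (j : ℕ) by ring]
  ring

lemma neg_zpow_neg_natCast {K : Type*} [Field K] (r : K) (j : ℕ) :
    (-r) ^ (-(j : ℤ)) = (-r⁻¹) ^ j := by
  rw [zpow_neg, zpow_natCast, ← inv_pow, inv_neg]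

lemma neg_zpow_neg_natCast_sub_one {K : Type*} [Field K] {r : K} (hr : r ≠ 0) (j : ℕ) :
    (-r) ^ (-((j : ℤ) - 1)) = -r * (-r⁻¹) ^ j := by
  rw [neg_sub, sub_eq_add_neg, zpow_add₀ (neg_ne_zero.2 hr), zpow_one, neg_zpow_neg_natCast]

open PowerSeries in
lemma one_add_X_mul_colJ {K : Type*} [Field K] {q : K} (hq : q ≠ 0) {n j : ℕ} (hj : j ≤ n) :
    (1 + X) * colJ n q j =
      C (-(q - q⁻¹)⁻¹) * (1 + X) ^ j *
        (C ((-q⁻¹) ^ j) * (1 - C q * (1 + X)) ^ n * (1 - C (q ^ 2) * (1 + X)) -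
          C ((-q) ^ j) * (1 - C q⁻¹ * (1 + X)) ^ n * (1 - (1 + X))) := by
  have hq' := inv_ne_zero hq
  have h1 := one_add_X_mul_binomGen n (neg_ne_zero.2 hq) (j := j) (t := j - 1) (a := -n)
    (b := n + 1) (e := j + 1) (by push_cast; ring) (by omega) (by omega)
  have h2 := one_add_X_mul_binomGen n (neg_ne_zero.2 hq') (j := j) (t := j - 1) (a := -n)
    (b := n + 1) (e := j + 1) (by push_cast; ring) (by omega) (by omega)
  have h3 := one_add_X_mul_binomGen n (neg_ne_zero.2 hq) (j := j) (t := j) (a := -n)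
    (b := n + 1) (e := j) (by ring) (by omega) (by omega)
  have h4 := one_add_X_mul_binomGen n (neg_ne_zero.2 hq') (j := j) (t := j) (a := -n)
    (b := n + 1) (e := j) (by ring) (by omega) (by omega)
  rw [neg_zpow_neg_natCast_sub_one hq] at h1
  rw [neg_zpow_neg_natCast_sub_one hq', inv_inv] at h2
  rw [neg_zpow_neg_natCast] at h3 h4
  rw [inv_inv] at h4
  have hc : (C q : PowerSeries K) * C q⁻¹ = 1 := by rw [← map_mul, mul_inv_cancel₀ hq, map_one]
  simp only [map_mul, map_neg, map_pow, neg_mul, ← sub_eq_add_neg] at h1 h2 h3 h4 ⊢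
  rw [colJ]
  simp only [map_neg]
  linear_combination (-C (q - q⁻¹)⁻¹) * (C q * (h1 - h2) + h3 - h4) +
    (-C (q - q⁻¹)⁻¹) * (-C q) ^ j * (1 + X) ^ (j + 1) * (1 - C q⁻¹ * (1 + X)) ^ n * hc

open PowerSeries in
lemma one_add_X_mul_colL {K : Type*} [Field K] {q : K} (hq : q ≠ 0) {n j : ℕ} (hj : j < n) :
    (1 + X) * colL n q j =
      C (-(q - q⁻¹)⁻¹) * (1 + X) ^ j *
        (C ((-q⁻¹) ^ j) * (1 - C q * (1 + X)) ^ n - C ((-q) ^ j) * (1 - C q⁻¹ * (1 + X)) ^ n) := by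
  have hq' := inv_ne_zero hq
  have h3 := one_add_X_mul_binomGen n (neg_ne_zero.2 hq) (j := j) (t := j) (a := -n + 1)
    (b := n) (e := j) (by ring) (by omega) (by omega)
  have h4 := one_add_X_mul_binomGen n (neg_ne_zero.2 hq') (j := j) (t := j) (a := -n + 1)
    (b := n) (e := j) (by ring) (by omega) (by omega)
  rw [neg_zpow_neg_natCast] at h3 h4
  rw [inv_inv] at h4
  simp only [map_neg, map_pow, neg_mul, ← sub_eq_add_neg] at h3 h4 ⊢
  rw [colL]
  simp only [map_neg]
  linear_combination (-C (q - q⁻¹)⁻¹) * (h3 - h4)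

open PowerSeries in
/-- Two adjacent columns of `J` combine to a multiple of a column of `L`. -/
lemma colJ_add_smul_colJ_succ {K : Type*} [Field K] {q : K} (hq : q ≠ 0) {n j : ℕ} (hj : j < n) :
    colJ n q j + C q * colJ n q (j + 1) =
      -X * ((1 - C (q ^ 2) * (1 + X)) * colL n q j) := by
  have hy : (1 + X : PowerSeries K) ≠ 0 := fun h => by
    simpa using congrArg constantCoeff h
  refine mul_left_cancel₀ hy ?_
  have h1 := one_add_X_mul_colJ hq hj.le
  have h2 := one_add_X_mul_colJ hq (Nat.succ_le_of_lt hj)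
  have h3 := one_add_X_mul_colL hq hj
  have hc : (C q : PowerSeries K) * C q⁻¹ = 1 := by rw [← map_mul, mul_inv_cancel₀ hq, map_one]
  simp only [map_neg, map_pow, Nat.succ_eq_add_one] at h1 h2 h3 ⊢
  linear_combination h1 + C q * h2 + X * (1 - C q ^ 2 * (1 + X)) * h3 +
    C (q - q⁻¹)⁻¹ * (1 + X) ^ (j + 1) * (-C q⁻¹) ^ j * (1 - C q * (1 + X)) ^ n *
      (1 - C q ^ 2 * (1 + X)) * hc

open PowerSeries in
lemma coeff_zero_colJ_zero {K : Type*} [Field K] {q : K} (hq : q ≠ 0) (hq' : q - q⁻¹ ≠ 0) (n : ℕ) :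
    coeff 0 (colJ n q 0) = q * (1 - q) ^ n := by
  have h := congrArg constantCoeff (one_add_X_mul_colJ hq (Nat.zero_le n))
  simp only [map_mul, map_add, map_sub, map_one, map_pow, constantCoeff_X, constantCoeff_C,
    pow_zero, add_zero, one_mul, mul_one, sub_self, mul_zero, sub_zero] at h
  rw [coeff_zero_eq_constantCoeff_apply, h]
  have : 1 - q ^ 2 = -q * (q - q⁻¹) := by
    field_simp
    ring
  rw [this]
  linear_combination q * (1 - q) ^ n * inv_mul_cancel₀ hq'

open PowerSeries in
/-- Multiplying all columns by a linear series multiplies the determinant by a power of the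
constant term. -/
lemma det_coeff_linear_mul {K : Type*} [Field K] {n : ℕ} {a : K} (ha : a ≠ 0) (b : K)
    (f : Fin n → PowerSeries K) :
    (Matrix.of fun i j : Fin n => coeff i ((C a + C b * X) * f j)).det =
      a ^ n * (Matrix.of fun i j : Fin n => coeff i (f j)).det := by
  cases n with
  | zero => simp
  | succ n =>
    have h := Matrix.det_mul_column (fun _ : Fin (n + 1) => a)
      (Matrix.of fun i j : Fin (n + 1) => coeff i (f j))
    rw [Finset.prod_const, Finset.card_univ, Fintype.card_fin] at h
    rw [← h]
    symm
    -- Row `i + 1` of the product is `a` times row `i + 1` plus `b` times row `i` of the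
    -- coefficients of `f`; the latter is `b / a` times the scaled row `i`.
    refine Matrix.det_eq_of_forall_row_eq_smul_add_pred (fun _ => -(b / a)) (fun j => ?_)
      fun i j => ?_
    · simp
    · simp only [Matrix.of_apply, Fin.val_succ, Fin.val_castSucc, add_mul, mul_assoc, map_add,
        coeff_C_mul, coeff_succ_X_mul]
      field_simp
      ring

open PowerSeries in
theorem det_matrixJ {K : Type*} [Field K] {q : K} (hq0 : q ≠ 0) (hq : q - q⁻¹ ≠ 0) (n : ℕ) :
    (matrixJ n q).det = q * (1 - q) ^ n * (q - q⁻¹) ^ n * (matrixL n q).det := by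
  have hs : 1 - q ^ 2 = -q * (q - q⁻¹) := by
    field_simp
    ring
  have ha : -(1 - q ^ 2) ≠ 0 := by
    rw [hs, neg_mul, neg_neg]
    exact mul_ne_zero hq0 hq
  have hL : (matrixL n q).det = (Matrix.of fun i j : Fin n => coeff i (colL n q j)).det :=
    congrArg _ (Matrix.ext fun i j => matrixL_apply n q i j)
  set N : Matrix (Fin (n + 1)) (Fin (n + 1)) K := Matrix.of fun i j =>
    coeff i (Fin.cases (colJ n q 0)
      (fun l : Fin n => colJ n q l + C q * colJ n q (l + 1)) j : PowerSeries K) with hN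
  have hN0 : N.det = q * (1 - q) ^ n * ((-(1 - q ^ 2)) ^ n * (matrixL n q).det) := by
    rw [Matrix.det_succ_row_zero, Fin.sum_univ_succ, Finset.sum_eq_zero, add_zero, hL,
      ← det_coeff_linear_mul ha (q ^ 2)]
    · congr 1
      · simp [hN, coeff_zero_colJ_zero hq0 hq, -coeff_zero_eq_constantCoeff]
      · congr 1
        ext i j
        simp only [hN, Matrix.submatrix_apply, Matrix.of_apply, Fin.zero_succAbove, Fin.cases_succ,
          colJ_add_smul_colJ_succ hq0 j.isLt, Fin.val_succ]
        -- The factor `X` absorbs the row shift of the minor; what remains is the linear factor `-(1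
        -- - q ^ 2) + q ^ 2 * X`.
        rw [neg_mul_comm, coeff_succ_X_mul]
        congr 1
        simp only [map_sub, map_neg, map_one]
        ring
    · intro j _
      simp [hN, colJ_add_smul_colJ_succ hq0 j.isLt]
  -- Scaling column `j` by `q ^ j` turns the combinations into unipotent column operations.
  -- Comparing the scalings on both sides gives `q ^ n * det J = det N`.
  have hcol : (Matrix.of fun i j : Fin (n + 1) => q ^ (j : ℕ) * matrixJ n q i j).det =
      (Matrix.of fun i j : Fin (n + 1) =>
        (Fin.cases 1 (fun l : Fin n => q ^ (l : ℕ)) j : K) * N i j).det := by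
    refine Matrix.det_eq_of_forall_col_eq_smul_add_pred (fun _ => -1) (fun i => ?_) fun i j => ?_
    · simp [hN, matrixJ_apply]
    · simp only [hN, matrixJ_apply, Matrix.of_apply, Fin.cases_succ, Fin.val_succ, Fin.val_castSucc,
        map_add, coeff_C_mul]
      ring
  rw [Matrix.det_mul_row, Matrix.det_mul_row, Fin.prod_univ_castSucc, Fin.prod_univ_succ] at hcol
  simp only [Fin.val_castSucc, Fin.val_last, Fin.cases_zero, Fin.cases_succ, one_mul] at hcol
  have hp : ∏ l : Fin n, q ^ (l : ℕ) ≠ 0 := Finset.prod_ne_zero_iff.2 fun l _ => pow_ne_zero _ hq0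
  rw [mul_assoc] at hcol
  have h := mul_left_cancel₀ hp hcol
  rw [hN0, hs, neg_mul, neg_neg, mul_pow] at h
  refine mul_left_cancel₀ (pow_ne_zero n hq0) ?_
  rw [h]
  ring

lemma matrixL_inv {K : Type*} [Field K] (n : ℕ) (q : K) : matrixL n q⁻¹ = matrixL n q := by
  ext i j
  simp only [matrixL, entryL, Matrix.of_apply]
  refine Finset.sum_congr rfl fun k _ => ?_
  rw [inv_inv, inv_zpow', inv_zpow', neg_neg, ← neg_sub (q ^ k), ← neg_sub q, neg_div_neg_eq]

theorem corollary5p2 {K : Type*} [Field K] (q : K) (hq0 : q ≠ 0) (hq : q - q⁻¹ ≠ 0)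
    (n : ℕ) (hn : 0 < n) :
    (matrixJ n q).det = q ^ (n + 2) * (matrixJ n q⁻¹).det ∧
      q ^ (n + 2) * (matrixJ n q⁻¹).det =
        q * (1 - q) ^ n * (q - q⁻¹) ^ n * (matrixL n q).det := by
  have hinv : q⁻¹ - q⁻¹⁻¹ ≠ 0 := by
    rw [inv_inv, ← neg_sub]
    exact neg_ne_zero.2 hq
  have h : q ^ (n + 2) * (matrixJ n q⁻¹).det =
      q * (1 - q) ^ n * (q - q⁻¹) ^ n * (matrixL n q).det := by
    have hpow : q ^ n * ((1 - q⁻¹) ^ n * (q⁻¹ - q) ^ n) = (1 - q) ^ n * (q - q⁻¹) ^ n := by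
      rw [← mul_pow, ← mul_pow, ← mul_pow]
      congr 1
      field_simp
      ring
    have hqq : q ^ 2 * q⁻¹ = q := by field_simp
    rw [det_matrixJ (inv_ne_zero hq0) hinv, matrixL_inv, inv_inv]
    linear_combination (q ^ 2 * q⁻¹ * (matrixL n q).det) * hpow +
      ((1 - q) ^ n * (q - q⁻¹) ^ n * (matrixL n q).det) * hqq
  exact ⟨(det_matrixJ hq0 hq n).trans h.symm, h⟩
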